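/- Consider a (unitary) two-dimensional rational conformal model: a finite set of primaries containing the vacuum $0$, charge conjugation $p\mapsto\bar p$, a symmetric unitary modular matrix $S$ with $S_{0p}>0$ and $S_{\bar p q}=\overline{S_{pq}}$, and fusion rule coefficients $N_{pq}^r\in\mathbb{Z}_{\ge 0}$ given by Verlinde's formula $N_{pq}^{r}=\sum_s S_{ps}S_{qs}\overline{S_{rs}}/S_{0s}$. Put $d_p=S_{0p}/S_{00}$ and $\rho_p(\alpha)=S_{\alpha p}/S_{0p}$. Let $\mathscr{L}$ be the set, ordered by inclusion, of all sets $\mathfrak g$ of primaries that contain $0$ and are closed under fusion ($p,q\in\mathfrak g$ and $N_{pq}^r>0$ imply $r\in\mathfrak g$). For $\mathfrak g\in\mathscr L$, a $\mathfrak g$-class is an equivalence class of the relation "$\rho_p(\alpha)=\rho_q(\alpha)$ for all $\alpha\in\mathfrak g$" on primaries, and $\mathfrak g^{\perp}\in\mathscr L$ is the $\mathfrak g$-class of $0$. The mass of a class $\mathtt C$ is $\sum_{p\in \mathtt C}d_p^2$. The center $\mathtt Z(\mathfrak g)$ is the set of central $\mathfrak g$-classes, i.e. those with the same mass as $\mathfrak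 g^\perp$; it is an abelian group with identity $\mathfrak g^\perp$, the product of $\mathtt z$ and $\mathtt w$ being $\{r : N_{pq}^r>0 \text{ for some } p\in\mathtt z,\ q\in\mathtt w\}$. For a subgroup $H<\mathtt Z(\mathfrak g)$, the central quotient $\mathfrak g/H\in\mathscr L$ is the set of those $\alpha\in\mathfrak g$ with $\rho_p(\alpha)=d_\alpha$ for all $\mathtt z\in H$ and $p\in\mathtt z$. Put $\boldsymbol\partial\mathfrak g=\mathfrak g/\mathtt Z(\mathfrak g)$ (the maximal central quotient) and $\mathfrak g^{\intercal}=(\boldsymbol\partial(\mathfrak g^\perp))^\perp$ (the maximal central extension). For $\mathfrak h\subseteq\mathfrak g$ in $\mathscr L$ put $\mathtt Z(\mathfrak g|\mathfrak h)=\{\mathtt z\in\mathtt Z(\mathfrak g) : \mathtt z\subseteq\mathfrak h^\perp\}$, a subgroup of $\mathtt Z(\mathfrak g)$; the restriction homomorphism $\mathtt Z(\mathfrak g)\to\mathtt Z(\mathfrak h)$ sends a central $\mathfrak g$-class to the $\mathfrak h$-class that contains it. Let $\mathfrak g,\mathfrak h\in\mathscr L$, and suppose that $\mathfrak h$ is a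 central quotient of $\mathfrak g$, i.e. $\mathfrak h=\mathfrak g/H$ for some subgroup $H<\mathtt Z(\mathfrak g)$. Then $\mathfrak g^\perp\subseteq\mathfrak h^\perp$ and $\mathfrak h^\intercal\subseteq\mathfrak g^\intercal$, and there is a four-term exact sequence of abelian groups $$1\to\mathtt Z(\mathfrak g|\mathfrak h)\to\mathtt Z(\mathfrak h^\perp)\to\mathtt Z(\mathfrak g^\perp)\to\mathtt Z(\mathfrak g^{\intercal}|\mathfrak h^{\intercal})\to 1$$ whose middle map is the restriction homomorphism. -/

import Mathlib

/-- The data of a (unitary) two-dimensional rational conformal model with finite set `P` of primaries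
which govern its fusion: the vacuum, the charge conjugation, the fusion rule coefficients
`N p q r` (multiplicity of `r` in the fusion product of `p` and `q`) and the modular matrix `S`,
related to the fusion rules by Verlinde's formula. The conformal weights play no role in the notions
below, so no condition on them is imposed. -/
structure RationalModel (P : Type*) [Fintype P] [DecidableEq P] where
  vac : P
  conj : P → P
  N : P → P → P → ℕ
  S : Matrix P P ℂ
  symm : S.IsSymm
  unitary : S * S.conjTranspose = 1
  vac_pos : ∀ p, 0 < (S vac p).re ∧ (S vac p).im = 0
  S_conj : ∀ p q, S (conj p) q = star (S p q)
  verlinde : ∀ p q r, (N p q r : ℂ) = ∑ s, S p s * S q s * star (S r s) / S vac s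

namespace RationalModel

variable {P : Type*} [Fintype P] [DecidableEq P] (M : RationalModel P)

/-- The quantum dimension of a primary. -/
noncomputable def qdim (p : P) : ℝ := (M.S M.vac p).re / (M.S M.vac M.vac).re

/-- The value at the primary `a` of the irreducible representation of the fusion algebra that
corresponds to the primary `p`. -/
noncomputable def rho (p a : P) : ℂ := M.S a p / M.S M.vac p

/-- The mass of a set of primaries. -/
noncomputable def mass (C : Set P) : ℝ := ∑ p, C.indicator (fun p => M.qdim p ^ 2) p

/-- All constituents of fusion products of an element of `A` with one of `B`. -/
def fusionProd (A B : Set P) : Set P := {r | ∃ p ∈ A, ∃ q ∈ B, 0 < M.N p q r}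

/-- Auxiliary normalization of the matrix `S` (symmetric, and at most 1 in absolute value). -/
noncomputable def nu (p a : P) : ℂ :=
  M.S p a * M.S M.vac M.vac / (M.S M.vac p * M.S M.vac a)

/-- Auxiliary: the vacuum row of `S` as real numbers. -/
noncomputable def s (p : P) : ℝ := (M.S M.vac p).re

theorem s_pos (p : P) : 0 < M.s p := (M.vac_pos p).1

theorem S_vac (p : P) : M.S M.vac p = (M.s p : ℂ) :=
  Complex.ext (by simp [s]) (by simp [(M.vac_pos p).2])

theorem s_ne (p : P) : (M.s p : ℂ) ≠ 0 := by exact_mod_cast (M.s_pos p).ne'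

theorem S_symm (p q : P) : M.S p q = M.S q p := M.symm.apply q p

theorem S_vac' (p : P) : M.S p M.vac = (M.s p : ℂ) := by rw [M.S_symm, M.S_vac]

theorem orth (p q : P) : ∑ r, M.S p r * star (M.S q r) = if p = q then 1 else 0 := by
  have h := congrFun (congrFun M.unitary p) q
  rw [Matrix.mul_apply, Matrix.one_apply] at h
  simpa [Matrix.conjTranspose_apply] using h

theorem fusion_S (p q a : P) :
    M.S p a * M.S q a = M.s a * ∑ r, (M.N p q r : ℂ) * M.S r a := by
  have h : ∑ r, (M.N p q r : ℂ) * M.S r a = M.S p a * M.S q a / M.s a := by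
    calc ∑ r, (M.N p q r : ℂ) * M.S r a
        = ∑ r, ∑ t, (M.S p t * M.S q t / M.s t) * (M.S a r * star (M.S t r)) := by
          refine Finset.sum_congr rfl fun r _ => ?_
          rw [M.verlinde, Finset.sum_mul]
          refine Finset.sum_congr rfl fun t _ => ?_
          rw [M.S_vac, M.S_symm r a, M.S_symm r t]; ring
      _ = ∑ t, (M.S p t * M.S q t / M.s t) * (if a = t then 1 else 0) := by
          rw [Finset.sum_comm]
          refine Finset.sum_congr rfl fun t _ => ?_
          rw [← Finset.mul_sum, M.orth]
      _ = _ := by simp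
  rw [h]
  have := M.s_ne a
  field_simp

theorem fusion_s (p q : P) : M.s p * M.s q = M.s M.vac * ∑ r, (M.N p q r : ℝ) * M.s r := by
  have h := M.fusion_S p q M.vac
  simp only [S_vac'] at h
  exact_mod_cast h

theorem N_conj (p q r : P) : M.N (M.conj p) r q = M.N p q r := by
  have h : (M.N (M.conj p) r q : ℂ) = star (M.N p q r : ℂ) := by
    rw [M.verlinde, M.verlinde, star_sum]
    refine Finset.sum_congr rfl fun t _ => ?_
    simp only [S_conj, S_vac, star_div₀, star_mul', star_star]
    simp only [RCLike.star_def, Complex.conj_ofReal]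
    ring
  simpa using h

theorem N_comm (p q r : P) : M.N p q r = M.N q p r := by
  have h : (M.N p q r : ℂ) = M.N q p r := by
    rw [M.verlinde, M.verlinde]
    refine Finset.sum_congr rfl fun t _ => by ring
  exact_mod_cast h

theorem N_vac (p : P) : M.N M.vac p p = 1 := by
  have h : (M.N M.vac p p : ℂ) = 1 := by
    rw [M.verlinde]
    have h1 := M.orth p p
    rw [if_pos rfl] at h1
    rw [← h1]
    refine Finset.sum_congr rfl fun t _ => ?_
    have := M.s_ne t
    rw [M.S_vac]
    field_simp
  exact_mod_cast h

theorem exists_fusion (p q : P) : ∃ r, 0 < M.N p q r := by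
  by_contra! h
  have h1 := M.fusion_s p q
  have h2 : ∑ r, (M.N p q r : ℝ) * M.s r = 0 :=
    Finset.sum_eq_zero fun r _ => by simp [Nat.le_zero.mp (h r)]
  rw [h2, mul_zero] at h1
  exact (mul_pos (M.s_pos p) (M.s_pos q)).ne' h1

theorem S_eq_nu (p a : P) : M.S p a = M.nu p a * (M.s p * M.s a / M.s M.vac) := by
  have := M.s_ne p
  have := M.s_ne a
  have := M.s_ne M.vac
  rw [nu, M.S_vac, M.S_vac, M.S_vac]
  field_simp

theorem nu_symm (p a : P) : M.nu p a = M.nu a p := by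
  rw [nu, nu, M.S_symm, mul_comm (M.S M.vac p)]

theorem nu_vac (a : P) : M.nu M.vac a = 1 := by
  have := M.s_ne a
  have := M.s_ne M.vac
  rw [nu, M.S_vac, M.S_vac]
  field_simp

theorem nu_conj (p a : P) : M.nu (M.conj p) a = star (M.nu p a) := by
  have h : M.S M.vac (M.conj p) = M.S M.vac p := by
    rw [M.S_symm, M.S_conj, M.S_vac', M.S_vac]; simp
  rw [nu, nu, M.S_conj, h]
  simp [M.S_vac]

theorem fusion_nu (p q a : P) :
    M.nu p a * M.nu q a * (M.s p * M.s q)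
      = M.s M.vac * ∑ r, (M.N p q r : ℂ) * M.s r * M.nu r a := by
  have h := M.fusion_S p q a
  have h1 := M.s_ne a
  have h2 := M.s_ne M.vac
  have h3 : ∑ r, (M.N p q r : ℂ) * M.S r a
      = (M.s a / M.s M.vac) * ∑ r, (M.N p q r : ℂ) * M.s r * M.nu r a := by
    rw [Finset.mul_sum]
    refine Finset.sum_congr rfl fun r _ => ?_
    rw [M.S_eq_nu r a]; ring
  rw [h3, M.S_eq_nu p a, M.S_eq_nu q a] at h
  field_simp at h
  linear_combination h

theorem norm_nu_le (p a : P) : ‖M.nu p a‖ ≤ 1 := by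
  obtain ⟨q, -, hq⟩ := Finset.exists_max_image (Finset.univ : Finset P) (fun q => ‖M.nu q a‖)
    ⟨M.vac, Finset.mem_univ _⟩
  have hq1 : 0 < ‖M.nu q a‖ := by
    refine lt_of_lt_of_le ?_ (hq M.vac (Finset.mem_univ _))
    simp [nu_vac]
  have h := congrArg norm (M.fusion_nu p q a)
  have hpq := mul_pos (M.s_pos p) (M.s_pos q)
  have h0 := M.s_pos M.vac
  rw [norm_mul, norm_mul, norm_mul, norm_mul, Complex.norm_real, Complex.norm_real,
    Complex.norm_real, Real.norm_of_nonneg (M.s_pos p).le, Real.norm_of_nonneg (M.s_pos q).le,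
    Real.norm_of_nonneg h0.le] at h
  have h2 : ‖∑ r, (M.N p q r : ℂ) * M.s r * M.nu r a‖
      ≤ ∑ r, (M.N p q r : ℝ) * M.s r * ‖M.nu q a‖ := by
    refine (norm_sum_le _ _).trans (Finset.sum_le_sum fun r _ => ?_)
    rw [norm_mul, norm_mul, Complex.norm_real, Real.norm_of_nonneg (M.s_pos r).le,
      Complex.norm_natCast]
    exact mul_le_mul_of_nonneg_left (hq r (Finset.mem_univ _))
      (mul_nonneg (Nat.cast_nonneg _) (M.s_pos r).le)
  rw [← Finset.sum_mul] at h2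
  have h3 := M.fusion_s p q
  have h4 : ‖M.nu p a‖ * (‖M.nu q a‖ * (M.s p * M.s q)) ≤ 1 * (‖M.nu q a‖ * (M.s p * M.s q)) := by
    calc _ = ‖M.nu p a‖ * ‖M.nu q a‖ * (M.s p * M.s q) := by ring
      _ ≤ M.s M.vac * ((∑ r, (M.N p q r : ℝ) * M.s r) * ‖M.nu q a‖) := by
        rw [h]; exact mul_le_mul_of_nonneg_left h2 h0.le
      _ = _ := by rw [h3]; ring
  exact le_of_mul_le_mul_right h4 (mul_pos hq1 hpq)

theorem nu_fusion {p q r a : P} (hp : ‖M.nu p a‖ = 1) (hq : ‖M.nu q a‖ = 1)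
    (hr : 0 < M.N p q r) : M.nu r a = M.nu p a * M.nu q a := by
  set w := M.nu p a * M.nu q a with hw
  have hw1 : ‖w‖ = 1 := by rw [hw, norm_mul, hp, hq, one_mul]
  have hww : w * star w = 1 := by
    rw [RCLike.star_def, Complex.mul_conj, Complex.normSq_eq_norm_sq, hw1]; simp
  have h := congrArg (fun x => (x * star w).re) (M.fusion_nu p q a)
  have e1 : M.nu p a * M.nu q a * (M.s p * M.s q : ℂ) * star w = ((M.s p * M.s q : ℝ) : ℂ) := by
    rw [← hw]; push_cast; linear_combination (M.s p * M.s q : ℂ) * hww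
  have e2 : (M.s M.vac * ∑ r, (M.N p q r : ℂ) * M.s r * M.nu r a) * star w
      = ((M.s M.vac : ℝ) : ℂ) *
        ∑ r, (((M.N p q r : ℝ) * M.s r : ℝ) : ℂ) * (M.nu r a * star w) := by
    rw [mul_assoc, Finset.sum_mul]
    congr 1
    refine Finset.sum_congr rfl fun r _ => ?_
    push_cast; ring
  simp only [e1, e2, Complex.re_ofReal_mul, Complex.re_sum, Complex.ofReal_re] at h
  rw [M.fusion_s p q] at h
  have h5 := mul_left_cancel₀ (M.s_pos M.vac).ne' h
  have hle : ∀ t, (M.nu t a * star w).re ≤ 1 := fun t => by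
    refine (Complex.re_le_norm _).trans ?_
    rw [norm_mul, norm_star, hw1, mul_one]
    exact M.norm_nu_le t a
  have h6 : ∀ t ∈ Finset.univ, (M.N p q t : ℝ) * M.s t * (M.nu t a * star w).re
      = (M.N p q t : ℝ) * M.s t := by
    refine (Finset.sum_eq_sum_iff_of_le fun t _ => ?_).mp h5.symm
    exact mul_le_of_le_one_right (mul_nonneg (Nat.cast_nonneg _) (M.s_pos t).le) (hle t)
  have h7 := h6 r (Finset.mem_univ _)
  have h8 : (M.nu r a * star w).re = 1 :=
    mul_left_cancel₀ (mul_pos (Nat.cast_pos.mpr hr) (M.s_pos r)).ne' (h7.trans (mul_one _).symm)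
  have h9 : ‖M.nu r a * star w‖ ≤ 1 := by
    rw [norm_mul, norm_star, hw1, mul_one]; exact M.norm_nu_le r a
  have h10 : M.nu r a * star w = 1 := by
    have h11 : (M.nu r a * star w).re * (M.nu r a * star w).re
        + (M.nu r a * star w).im * (M.nu r a * star w).im ≤ 1 := by
      rw [← Complex.normSq_apply, Complex.normSq_eq_norm_sq]
      exact pow_le_one₀ (norm_nonneg _) h9
    refine Complex.ext (by simpa using h8) ?_
    rw [h8] at h11
    have : (M.nu r a * star w).im * (M.nu r a * star w).im = 0 :=
      le_antisymm (by linarith) (mul_self_nonneg _)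
    simpa using mul_self_eq_zero.mp this
  linear_combination w * h10 - M.nu r a * hww

theorem rho_eq_nu (p a : P) : M.rho p a = M.nu p a * (M.s a / M.s M.vac) := by
  have := M.s_ne p
  rw [rho, M.S_symm, M.S_eq_nu, M.S_vac]
  field_simp

theorem rho_eq_iff {p q a : P} : M.rho p a = M.rho q a ↔ M.nu p a = M.nu q a := by
  rw [rho_eq_nu, rho_eq_nu]
  exact mul_left_inj' (div_ne_zero (M.s_ne a) (M.s_ne M.vac))

theorem rho_vac_eq_iff {p a : P} : M.rho p a = M.rho M.vac a ↔ M.nu p a = 1 := by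
  rw [rho_eq_iff, nu_vac]

/-- The elements of the deconstruction lattice: sets of primaries which contain the vacuum and are
closed under the fusion product. -/
@[ext]
structure FusionSet where
  carrier : Set P
  vac_mem : M.vac ∈ carrier
  fusion_mem : ∀ {p q r}, p ∈ carrier → q ∈ carrier → 0 < M.N p q r → r ∈ carrier

namespace FusionSet

variable {M}

instance : SetLike M.FusionSet P where
  coe := FusionSet.carrier
  coe_injective _ _ h := FusionSet.ext h

/-- The ordering of the deconstruction lattice is set inclusion. -/
instance : PartialOrder M.FusionSet := PartialOrder.ofSetLike M.FusionSet P

/-- The `g`-class of the primary `p`. -/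
def classOf (g : M.FusionSet) (p : P) : Set P := {q | ∀ a ∈ g, M.rho q a = M.rho p a}

/-- The dual of `g`: the trivial class, i.e. the `g`-class of the vacuum. -/
def dual (g : M.FusionSet) : M.FusionSet where
  carrier := g.classOf M.vac
  vac_mem := fun _ _ => rfl
  fusion_mem := fun {p q r} hp hq hr a ha => by
    have h1 := M.rho_vac_eq_iff.mp (hp a ha)
    have h2 := M.rho_vac_eq_iff.mp (hq a ha)
    rw [M.rho_vac_eq_iff, M.nu_fusion (by simp [h1]) (by simp [h2]) hr, h1, h2, one_mul]

theorem mem_classOf {g : M.FusionSet} {p q : P} :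
    q ∈ g.classOf p ↔ ∀ a ∈ g, M.nu q a = M.nu p a := by
  simp only [classOf, Set.mem_ofPred_eq, M.rho_eq_iff]

theorem mem_dual {g : M.FusionSet} {q : P} : q ∈ g.dual ↔ ∀ a ∈ g, M.nu q a = 1 := by
  change q ∈ g.classOf M.vac ↔ _
  simp only [mem_classOf, M.nu_vac]

theorem dual_anti {g h : M.FusionSet} (hle : h ≤ g) : g.dual ≤ h.dual :=
  fun _ hq a ha => hq a (hle ha)

theorem conj_mem (g : M.FusionSet) {a : P} (ha : a ∈ g) : M.conj a ∈ g := by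
  classical
  have key : ∀ q r, q ∉ g → r ∈ g → M.N a q r = 0 := by
    let F : P → P → ℝ := fun q r => (M.N a q r : ℝ) * M.s r * M.s q
    have hF : ∀ q r, 0 ≤ F q r := fun q r =>
      mul_nonneg (mul_nonneg (Nat.cast_nonneg _) (M.s_pos r).le) (M.s_pos q).le
    have h0 := M.s_pos M.vac
    have hs : M.s (M.conj a) = M.s a := by
      have : (M.s (M.conj a) : ℂ) = M.s a := by
        rw [← M.S_vac', ← M.S_vac', M.S_conj, M.S_vac']; simp
      exact_mod_cast this
    have row : ∀ q, M.s M.vac * ∑ r, F q r = M.s a * M.s q * M.s q := fun q => by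
      rw [M.fusion_s a q, ← Finset.sum_mul]; ring
    have col : ∀ r, M.s M.vac * ∑ q, F q r = M.s a * M.s r * M.s r := fun r => by
      rw [← hs, M.fusion_s (M.conj a) r, mul_assoc, Finset.sum_mul]
      congr 1
      refine Finset.sum_congr rfl fun q _ => ?_
      rw [M.N_conj]; change (M.N a q r : ℝ) * M.s r * M.s q = _; ring
    let G : Finset P := Finset.univ.filter (· ∈ g)
    have hG : ∀ q, q ∈ G ↔ q ∈ g := fun q => by simp [G]
    have hrow : ∑ q ∈ G, ∑ r, F q r = ∑ q ∈ G, ∑ r ∈ G, F q r := by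
      refine Finset.sum_congr rfl fun q hq => ?_
      refine (Finset.sum_subset (Finset.subset_univ _) fun r _ hr => ?_).symm
      have : M.N a q r = 0 := by
        by_contra hne
        exact hr ((hG r).mpr (g.fusion_mem ha ((hG q).mp hq) (Nat.pos_of_ne_zero hne)))
      simp [F, this]
    have heq : ∑ r ∈ G, ∑ q ∈ G, F q r = ∑ r ∈ G, ∑ q, F q r := by
      rw [Finset.sum_comm, ← hrow]
      refine Finset.sum_congr rfl fun q _ => ?_
      exact mul_left_cancel₀ h0.ne' ((row q).trans (col q).symm)
    intro q r hq hr
    have h1 : ∀ r ∈ G, ∑ q ∈ G, F q r = ∑ q, F q r :=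
      (Finset.sum_eq_sum_iff_of_le fun r _ =>
        Finset.sum_le_sum_of_subset_of_nonneg (Finset.subset_univ _) fun q _ _ => hF q r).mp heq
    have h2 := h1 r ((hG r).mpr hr)
    have h3 : ∑ q ∈ Finset.univ \ G, F q r = 0 := by
      have := Finset.sum_sdiff (f := fun q => F q r) (Finset.subset_univ G)
      linarith
    have h4 := (Finset.sum_eq_zero_iff_of_nonneg fun q _ => hF q r).mp h3 q
      (by simp [hG, hq])
    have h5 : (M.N a q r : ℝ) = 0 := by
      rcases mul_eq_zero.mp h4 with h | h
      · rcases mul_eq_zero.mp h with h | h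
        · exact h
        · exact absurd h (M.s_pos r).ne'
      · exact absurd h (M.s_pos q).ne'
    exact_mod_cast h5
  by_contra hn
  have h1 := key _ _ hn g.vac_mem
  have h2 : M.N a (M.conj a) M.vac = 1 := by
    rw [← M.N_conj, M.N_comm, M.N_vac]
  omega

theorem rho_fusion (p b c : P) :
    M.rho p b * M.rho p c = ∑ a, (M.N b c a : ℂ) * M.rho p a := by
  have h := M.fusion_S b c p
  have h1 := M.s_ne p
  simp only [rho, M.S_vac, ← mul_div_assoc]
  rw [← Finset.sum_div]
  field_simp
  linear_combination h

theorem rho_conj (p a : P) : M.rho p (M.conj a) = star (M.rho p a) := by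
  rw [rho, rho, M.S_conj, M.S_vac, star_div₀]
  simp

/-- Orthogonality of the restrictions of the irreducible representations to `g`. -/
theorem rho_orth (g : M.FusionSet) {p x : P} (hx : x ∉ g.classOf p) :
    ∑ a, (g : Set P).indicator (fun a => M.rho x a * star (M.rho p a)) a = 0 := by
  classical
  simp only [classOf, Set.mem_ofPred_eq, not_forall] at hx
  obtain ⟨b, hb, hne⟩ := hx
  set E := ∑ a, (g : Set P).indicator (fun a => M.rho x a * star (M.rho p a)) a with hE
  have h1 : M.rho x b * E = M.rho p b * E := by
    calc M.rho x b * E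
        = ∑ a, ∑ c, (g : Set P).indicator
            (fun a => (M.N b a c : ℂ) * M.rho x c * star (M.rho p a)) a := by
          rw [hE, Finset.mul_sum]
          refine Finset.sum_congr rfl fun a _ => ?_
          by_cases ha : a ∈ (g : Set P)
          · simp only [Set.indicator_of_mem ha]
            rw [← mul_assoc, rho_fusion, Finset.sum_mul]
          · simp [Set.indicator_of_notMem ha]
      _ = ∑ c, ∑ a, (g : Set P).indicator
            (fun c => (M.N b a c : ℂ) * M.rho x c * star (M.rho p a)) c := by
          rw [Finset.sum_comm]
          refine Finset.sum_congr rfl fun c _ => Finset.sum_congr rfl fun a _ => ?_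
          by_cases hN : M.N b a c = 0
          · simp [Set.indicator, hN]
          · have hpos := Nat.pos_of_ne_zero hN
            have hac : a ∈ (g : Set P) ↔ c ∈ (g : Set P) := by
              refine ⟨fun h => g.fusion_mem hb h hpos, fun h => ?_⟩
              rw [← M.N_conj] at hpos
              exact g.fusion_mem (g.conj_mem hb) h hpos
            by_cases ha : a ∈ (g : Set P)
            · rw [Set.indicator_of_mem ha, Set.indicator_of_mem (hac.mp ha)]
            · rw [Set.indicator_of_notMem ha, Set.indicator_of_notMem (fun h => ha (hac.mpr h))]
      _ = M.rho p b * E := by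
          rw [hE, Finset.mul_sum]
          refine Finset.sum_congr rfl fun c _ => ?_
          by_cases hc : c ∈ (g : Set P)
          · simp only [Set.indicator_of_mem hc]
            have h2 := congrArg star (rho_fusion (M := M) p (M.conj b) c)
            rw [star_mul', rho_conj, star_star, star_sum] at h2
            have h3 : M.rho p b * (M.rho x c * star (M.rho p c))
              = M.rho x c * (M.rho p b * star (M.rho p c)) := by ring
            rw [h3, h2, Finset.mul_sum]
            refine Finset.sum_congr rfl fun a _ => ?_
            rw [M.N_conj, star_mul']
            simp only [star_natCast]
            ring
          · simp [Set.indicator_of_notMem hc]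
  have h2 : (M.rho x b - M.rho p b) * E = 0 := by linear_combination h1
  exact (mul_eq_zero.mp h2).resolve_left (sub_ne_zero.mpr hne)

/-- The mass of the class of `p` is inversely proportional to the sum of the `|ρ_p(a)|²`. -/
theorem mass_mul (g : M.FusionSet) (p : P) :
    M.mass (g.classOf p) * ∑ a, (g : Set P).indicator (fun a => ‖M.rho p a‖ ^ 2) a
      = (M.s M.vac ^ 2)⁻¹ := by
  classical
  have h0 := M.s_pos M.vac
  have h1 : ∀ a, ∑ x, (M.s x : ℂ) ^ 2 * M.rho x a = if a = M.vac then 1 else 0 := fun a => by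
    rw [← M.orth a M.vac]
    refine Finset.sum_congr rfl fun x _ => ?_
    have := M.s_ne x
    rw [rho, M.S_vac, RCLike.star_def, Complex.conj_ofReal]
    field_simp
  have hvac : M.rho p M.vac = 1 := by
    rw [rho, div_self]; rw [M.S_vac]; exact M.s_ne p
  have h2 : ∑ x, (M.s x : ℂ) ^ 2 *
      ∑ a, (g : Set P).indicator (fun a => M.rho x a * star (M.rho p a)) a = 1 := by
    simp only [Finset.mul_sum]
    rw [Finset.sum_comm]
    calc _ = ∑ a, (g : Set P).indicator (fun a => star (M.rho p a)) a *
              ∑ x, (M.s x : ℂ) ^ 2 * M.rho x a := by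
          refine Finset.sum_congr rfl fun a _ => ?_
          rw [Finset.mul_sum]
          refine Finset.sum_congr rfl fun x _ => ?_
          by_cases ha : a ∈ (g : Set P)
          · simp only [Set.indicator_of_mem ha]; ring
          · simp [Set.indicator_of_notMem ha]
      _ = 1 := by
          simp only [h1]
          have hv : M.vac ∈ (g : Set P) := g.vac_mem
          simp [Set.indicator_of_mem hv, hvac]
  have h3 : ∀ x, (M.s x : ℂ) ^ 2 *
      ∑ a, (g : Set P).indicator (fun a => M.rho x a * star (M.rho p a)) a
      = (((g.classOf p).indicator (fun x => M.s x ^ 2) x *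
        ∑ a, (g : Set P).indicator (fun a => ‖M.rho p a‖ ^ 2) a : ℝ) : ℂ) := fun x => by
    by_cases hx : x ∈ g.classOf p
    · rw [Set.indicator_of_mem hx]
      push_cast
      congr 1
      refine Finset.sum_congr rfl fun a _ => ?_
      by_cases ha : a ∈ (g : Set P)
      · simp only [Set.indicator_of_mem ha]
        rw [hx a ha, RCLike.star_def, Complex.mul_conj, Complex.normSq_eq_norm_sq]
      · simp [Set.indicator_of_notMem ha]
    · rw [g.rho_orth hx, Set.indicator_of_notMem hx]; simp
  simp only [h3] at h2
  rw [← Complex.ofReal_sum, ← Finset.sum_mul] at h2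
  have h4 : (∑ x, (g.classOf p).indicator (fun x => M.s x ^ 2) x) *
        ∑ a, (g : Set P).indicator (fun a => ‖M.rho p a‖ ^ 2) a = 1 := by exact_mod_cast h2
  have h5 : M.mass (g.classOf p)
      = (∑ x, (g.classOf p).indicator (fun x => M.s x ^ 2) x) / M.s M.vac ^ 2 := by
    rw [mass, Finset.sum_div]
    refine Finset.sum_congr rfl fun x _ => ?_
    by_cases hx : x ∈ g.classOf p
    · rw [Set.indicator_of_mem hx, Set.indicator_of_mem hx, qdim, div_pow]; rfl
    · simp [Set.indicator_of_notMem hx]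
  rw [h5, div_mul_eq_mul_div, h4, one_div]

theorem central_iff (g : M.FusionSet) (p : P) :
    M.mass (g.classOf p) = M.mass (g.classOf M.vac) ↔ ∀ a ∈ g, ‖M.nu p a‖ = 1 := by
  classical
  have hn : ∀ q a, ‖M.rho q a‖ ^ 2 = ‖M.nu q a‖ ^ 2 * (M.s a / M.s M.vac) ^ 2 := fun q a => by
    rw [M.rho_eq_nu, norm_mul, norm_div, Complex.norm_real, Complex.norm_real,
      Real.norm_of_nonneg (M.s_pos a).le, Real.norm_of_nonneg (M.s_pos M.vac).le, mul_pow]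
  have hd : ∀ a, 0 < (M.s a / M.s M.vac) ^ 2 := fun a =>
    pow_pos (div_pos (M.s_pos a) (M.s_pos M.vac)) 2
  have hpos : (0 : ℝ) < (M.s M.vac ^ 2)⁻¹ := inv_pos.mpr (pow_pos (M.s_pos M.vac) 2)
  have hp := g.mass_mul p
  have hv := g.mass_mul M.vac
  have hle : ∀ a ∈ (Finset.univ : Finset P),
      (g : Set P).indicator (fun a => ‖M.rho p a‖ ^ 2) a
        ≤ (g : Set P).indicator (fun a => ‖M.rho M.vac a‖ ^ 2) a := fun a _ => by
    by_cases ha : a ∈ (g : Set P)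
    · simp only [Set.indicator_of_mem ha, hn, M.nu_vac]
      refine mul_le_mul_of_nonneg_right ?_ (hd a).le
      simpa using M.norm_nu_le p a
    · simp [Set.indicator_of_notMem ha]
  have hterm : (∀ a ∈ (Finset.univ : Finset P),
      (g : Set P).indicator (fun a => ‖M.rho p a‖ ^ 2) a
        = (g : Set P).indicator (fun a => ‖M.rho M.vac a‖ ^ 2) a) ↔
      ∀ a ∈ g, ‖M.nu p a‖ = 1 := by
    refine ⟨fun h a ha => ?_, fun h a _ => ?_⟩
    · have h1 := h a (Finset.mem_univ _)
      have ha' : a ∈ (g : Set P) := ha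
      simp only [Set.indicator_of_mem ha', hn, M.nu_vac] at h1
      have h2 := mul_right_cancel₀ (hd a).ne' h1
      simp only [norm_one, one_pow] at h2
      exact (pow_eq_one_iff_of_nonneg (norm_nonneg _) two_ne_zero).mp h2
    · by_cases ha : a ∈ (g : Set P)
      · simp only [Set.indicator_of_mem ha, hn, M.nu_vac, h a ha, norm_one]
      · simp [Set.indicator_of_notMem ha]
  rw [← hterm, ← Finset.sum_eq_sum_iff_of_le hle]
  have hmv : M.mass (g.classOf M.vac) ≠ 0 := fun h => by
    rw [h, zero_mul] at hv; exact hpos.ne hv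
  have hsp : ∑ a, (g : Set P).indicator (fun a => ‖M.rho p a‖ ^ 2) a ≠ 0 := fun h => by
    rw [h, mul_zero] at hp; exact hpos.ne hp
  constructor
  · intro h
    rw [h] at hp
    exact mul_left_cancel₀ hmv (hp.trans hv.symm)
  · intro h
    rw [← h] at hv
    exact mul_right_cancel₀ hsp (hp.trans hv.symm)

/-- The center of `g`: the set of central `g`-classes, i.e. those whose mass is equal to that
of the trivial class. -/
def Center (g : M.FusionSet) : Type _ :=
  {C : Set P // (∃ p, C = g.classOf p) ∧ M.mass C = M.mass (g.classOf M.vac)}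

namespace Center

variable {g h : M.FusionSet}

/-- A central class, as a set of primaries. -/
def toSet (z : g.Center) : Set P := z.1

theorem self_mem (g : M.FusionSet) (p : P) : p ∈ g.classOf p := fun _ _ => rfl

theorem nonempty (z : g.Center) : ∃ p, p ∈ z.toSet := by
  obtain ⟨p, hp⟩ := z.2.1
  exact ⟨p, by rw [toSet, hp]; exact self_mem g p⟩

theorem classOf_eq {p q : P} (hq : q ∈ g.classOf p) : g.classOf q = g.classOf p := by
  ext r
  exact ⟨fun hr a ha => (hr a ha).trans (hq a ha), fun hr a ha => (hr a ha).trans (hq a ha).symm⟩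

theorem eq_classOf (z : g.Center) {p : P} (hp : p ∈ z.toSet) : z.toSet = g.classOf p := by
  obtain ⟨q, hq⟩ := z.2.1
  have hp' : p ∈ g.classOf q := by rw [← hq]; exact hp
  rw [classOf_eq hp']; exact hq

theorem norm_nu (z : g.Center) {p a : P} (hp : p ∈ z.toSet) (ha : a ∈ g) : ‖M.nu p a‖ = 1 := by
  refine (g.central_iff p).mp ?_ a ha
  rw [← z.eq_classOf hp]; exact z.2.2

/-- The central class of a primary. -/
def mk (g : M.FusionSet) (p : P) (hp : ∀ a ∈ g, ‖M.nu p a‖ = 1) : g.Center :=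
  ⟨g.classOf p, ⟨p, rfl⟩, (g.central_iff p).mpr hp⟩

theorem nu_eq (z : g.Center) {p q a : P} (hp : p ∈ z.toSet) (hq : q ∈ z.toSet) (ha : a ∈ g) :
    M.nu p a = M.nu q a := by
  rw [z.eq_classOf hq] at hp
  exact mem_classOf.mp hp a ha

theorem mem_of_nu_eq (z : g.Center) {p q : P} (hp : p ∈ z.toSet)
    (h : ∀ a ∈ g, M.nu q a = M.nu p a) : q ∈ z.toSet := by
  rw [z.eq_classOf hp]; exact mem_classOf.mpr h

theorem ext_nu {z w : g.Center} {p q : P} (hp : p ∈ z.toSet) (hq : q ∈ w.toSet)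
    (h : ∀ a ∈ g, M.nu p a = M.nu q a) : z = w := by
  apply Subtype.ext
  change z.toSet = w.toSet
  rw [z.eq_classOf hp, w.eq_classOf hq]
  exact classOf_eq (mem_classOf.mpr h)

theorem norm_nu_fusion (z w : g.Center) {p q r a : P} (hp : p ∈ z.toSet) (hq : q ∈ w.toSet)
    (hr : 0 < M.N p q r) (ha : a ∈ g) : M.nu r a = M.nu p a * M.nu q a :=
  M.nu_fusion (z.norm_nu hp ha) (w.norm_nu hq ha) hr

theorem fusionProd_eq (z w : g.Center) {p q r : P} (hp : p ∈ z.toSet) (hq : q ∈ w.toSet)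
    (hr : 0 < M.N p q r) : M.fusionProd z.toSet w.toSet = g.classOf r := by
  ext t
  constructor
  · rintro ⟨p', hp', q', hq', ht⟩
    refine mem_classOf.mpr fun a ha => ?_
    rw [norm_nu_fusion z w hp' hq' ht ha, norm_nu_fusion z w hp hq hr ha, z.nu_eq hp' hp ha,
      w.nu_eq hq' hq ha]
  · intro ht
    obtain ⟨q', hq'⟩ := M.exists_fusion (M.conj p) t
    have ht' := mem_classOf.mp ht
    have hpt : 0 < M.N p q' t := by rwa [M.N_conj] at hq'
    refine ⟨p, hp, q', w.mem_of_nu_eq hq fun a ha => ?_, hpt⟩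
    have hp1 := z.norm_nu hp ha
    have hrr := norm_nu_fusion z w hp hq hr ha
    have h1 : M.nu q' a = M.nu (M.conj p) a * M.nu t a := by
      refine M.nu_fusion ?_ ?_ hq'
      · rw [M.nu_conj, norm_star, hp1]
      · rw [ht' a ha, hrr, norm_mul, hp1, w.norm_nu hq ha, one_mul]
    rw [h1, ht' a ha, hrr, M.nu_conj, ← mul_assoc, mul_comm (star _), RCLike.star_def,
      Complex.mul_conj, Complex.normSq_eq_norm_sq, hp1]
    simp

/-- The product of central classes is induced by the fusion product. -/
instance : Mul g.Center where
  mul z w := ⟨M.fusionProd z.toSet w.toSet, by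
    obtain ⟨p, hp⟩ := z.nonempty
    obtain ⟨q, hq⟩ := w.nonempty
    obtain ⟨r, hr⟩ := M.exists_fusion p q
    rw [fusionProd_eq z w hp hq hr]
    refine ⟨⟨r, rfl⟩, (g.central_iff r).mpr fun a ha => ?_⟩
    rw [norm_nu_fusion z w hp hq hr ha, norm_mul, z.norm_nu hp ha, w.norm_nu hq ha, one_mul]⟩

/-- The identity is the trivial class. -/
instance : One g.Center where
  one := ⟨g.classOf M.vac, ⟨M.vac, rfl⟩, rfl⟩

/-- The inverse is given by charge conjugation. -/
instance : Inv g.Center where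
  inv z := ⟨{q | M.conj q ∈ z.toSet}, by
    obtain ⟨p, hp⟩ := z.nonempty
    have h : {q | M.conj q ∈ z.toSet} = g.classOf (M.conj p) := by
      ext q
      rw [mem_classOf, z.eq_classOf hp, Set.mem_ofPred_eq, mem_classOf]
      refine forall₂_congr fun a _ => ?_
      rw [M.nu_conj, M.nu_conj, star_eq_iff_star_eq, eq_comm]
    rw [h]
    refine ⟨⟨_, rfl⟩, (g.central_iff _).mpr fun a ha => ?_⟩
    rw [M.nu_conj, norm_star, z.norm_nu hp ha]⟩

theorem toSet_mul (z w : g.Center) : (z * w).toSet = M.fusionProd z.toSet w.toSet := rfl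

theorem toSet_one : (1 : g.Center).toSet = g.classOf M.vac := rfl

theorem mem_inv {z : g.Center} {q : P} : q ∈ z⁻¹.toSet ↔ M.conj q ∈ z.toSet := Iff.rfl

theorem nu_mul {z w : g.Center} {p q r a : P} (hp : p ∈ z.toSet) (hq : q ∈ w.toSet)
    (hr : r ∈ (z * w).toSet) (ha : a ∈ g) : M.nu r a = M.nu p a * M.nu q a := by
  obtain ⟨p', hp', q', hq', h⟩ := hr
  rw [norm_nu_fusion z w hp' hq' h ha, z.nu_eq hp' hp ha, w.nu_eq hq' hq ha]

theorem nu_one {r a : P} (hr : r ∈ (1 : g.Center).toSet) (ha : a ∈ g) : M.nu r a = 1 := by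
  rw [mem_classOf.mp hr a ha, M.nu_vac]

theorem nu_inv {z : g.Center} {p r a : P} (hp : p ∈ z.toSet) (hr : r ∈ z⁻¹.toSet) (ha : a ∈ g) :
    M.nu r a = star (M.nu p a) := by
  rw [← z.nu_eq (mem_inv.mp hr) hp ha, M.nu_conj, star_star]

instance : CommGroup g.Center where
  mul_assoc x y z := by
    obtain ⟨a, ha⟩ := x.nonempty
    obtain ⟨b, hb⟩ := y.nonempty
    obtain ⟨c, hc⟩ := z.nonempty
    obtain ⟨d, hd⟩ := (x * y).nonempty
    obtain ⟨e, he⟩ := (y * z).nonempty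
    obtain ⟨l, hl⟩ := (x * y * z).nonempty
    obtain ⟨r, hr⟩ := (x * (y * z)).nonempty
    refine ext_nu hl hr fun t ht => ?_
    rw [nu_mul hd hc hl ht, nu_mul ha hb hd ht, nu_mul ha he hr ht, nu_mul hb hc he ht, mul_assoc]
  one_mul x := by
    obtain ⟨a, ha⟩ := x.nonempty
    obtain ⟨o, ho⟩ := (1 : g.Center).nonempty
    obtain ⟨l, hl⟩ := (1 * x).nonempty
    refine ext_nu hl ha fun t ht => ?_
    rw [nu_mul ho ha hl ht, nu_one ho ht, one_mul]
  mul_one x := by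
    obtain ⟨a, ha⟩ := x.nonempty
    obtain ⟨o, ho⟩ := (1 : g.Center).nonempty
    obtain ⟨l, hl⟩ := (x * 1).nonempty
    refine ext_nu hl ha fun t ht => ?_
    rw [nu_mul ha ho hl ht, nu_one ho ht, mul_one]
  inv_mul_cancel x := by
    obtain ⟨a, ha⟩ := x.nonempty
    obtain ⟨b, hb⟩ := x⁻¹.nonempty
    obtain ⟨o, ho⟩ := (1 : g.Center).nonempty
    obtain ⟨l, hl⟩ := (x⁻¹ * x).nonempty
    refine ext_nu hl ho fun t ht => ?_
    rw [nu_mul hb ha hl ht, nu_inv ha hb ht, nu_one ho ht, mul_comm, RCLike.star_def,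
      Complex.mul_conj, Complex.normSq_eq_norm_sq, x.norm_nu ha ht]
    simp
  mul_comm x y := by
    obtain ⟨a, ha⟩ := x.nonempty
    obtain ⟨b, hb⟩ := y.nonempty
    obtain ⟨l, hl⟩ := (x * y).nonempty
    obtain ⟨r, hr⟩ := (y * x).nonempty
    refine ext_nu hl hr fun t ht => ?_
    rw [nu_mul ha hb hl ht, nu_mul hb ha hr ht, mul_comm]

end Center

/-- The central quotient `g/H` by a subgroup `H` of the center: the primaries of `g` on which the
central characters of all elements of `H` are trivial (the central character of `z` takes the value
`ρ_p(a) / d_a = ρ_p(a) / ρ_0(a)` at `a`, where `p` is any element of `z`). -/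
def quotient (g : M.FusionSet) (H : Subgroup g.Center) : M.FusionSet where
  carrier := {a | a ∈ g ∧ ∀ z ∈ H, ∀ p ∈ z.toSet, M.rho p a = M.rho M.vac a}
  vac_mem := ⟨g.vac_mem, fun z _ p _ => by
    rw [M.rho_vac_eq_iff, M.nu_symm, M.nu_vac]⟩
  fusion_mem := by
    rintro a b c ⟨ha, ha'⟩ ⟨hb, hb'⟩ hc
    refine ⟨g.fusion_mem ha hb hc, fun z hz p hp => ?_⟩
    have h1 := M.rho_vac_eq_iff.mp (ha' z hz p hp)
    have h2 := M.rho_vac_eq_iff.mp (hb' z hz p hp)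
    rw [M.nu_symm] at h1 h2
    rw [M.rho_vac_eq_iff, M.nu_symm, M.nu_fusion (by simp [h1]) (by simp [h2]) hc, h1, h2, one_mul]

/-- `h` is a central quotient of `g`. -/
def IsCentralQuotient (h g : M.FusionSet) : Prop := ∃ H : Subgroup g.Center, h = g.quotient H

theorem IsCentralQuotient.le {g h : M.FusionSet} (hq : h.IsCentralQuotient g) : h ≤ g := by
  obtain ⟨H, rfl⟩ := hq
  exact fun _ ha => ha.1

/-- The maximal central quotient of `g`. -/
def maxQuotient (g : M.FusionSet) : M.FusionSet := g.quotient ⊤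

/-- The maximal central extension of `g`, the dual of the maximal central quotient of its dual. -/
def maxExtension (g : M.FusionSet) : M.FusionSet := g.dual.maxQuotient.dual

/-- The restriction homomorphism, for `h ≤ g`: it assigns to each central `g`-class the `h`-class
that contains it (the set of primaries in the `h`-class of some element of `z`). -/
def res {g h : M.FusionSet} (hle : h ≤ g) : g.Center →* h.Center :=
  have key : ∀ (z : g.Center) (p : P), p ∈ z.toSet →
      {r | ∃ q ∈ z.toSet, r ∈ h.classOf q} = h.classOf p := fun z p hp => by
    ext r
    refine ⟨fun ⟨q, hq, hr⟩ => ?_, fun hr => ⟨p, hp, hr⟩⟩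
    refine mem_classOf.mpr fun a ha => ?_
    rw [mem_classOf.mp hr a ha, z.nu_eq hq hp (hle ha)]
  have cen : ∀ z : g.Center, (∃ p, {r | ∃ q ∈ z.toSet, r ∈ h.classOf q} = h.classOf p) ∧
      M.mass {r | ∃ q ∈ z.toSet, r ∈ h.classOf q} = M.mass (h.classOf M.vac) := fun z => by
    obtain ⟨p, hp⟩ := z.nonempty
    rw [key z p hp]
    exact ⟨⟨p, rfl⟩, (h.central_iff p).mpr fun a ha => z.norm_nu hp (hle ha)⟩
  have sub : ∀ (z : g.Center) (p : P), p ∈ z.toSet →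
      p ∈ Center.toSet (g := h) ⟨{r | ∃ q ∈ z.toSet, r ∈ h.classOf q}, cen z⟩ :=
    fun _ p hp => ⟨p, hp, Center.self_mem h p⟩
  MonoidHom.mk' (fun z => ⟨{r | ∃ q ∈ z.toSet, r ∈ h.classOf q}, cen z⟩) fun z w => by
    obtain ⟨p, hp⟩ := z.nonempty
    obtain ⟨q, hq⟩ := w.nonempty
    obtain ⟨r, hr⟩ := (z * w).nonempty
    obtain ⟨t, ht⟩ := Center.nonempty (g := h)
      (⟨{r | ∃ q ∈ z.toSet, r ∈ h.classOf q}, cen z⟩ *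
        ⟨{r | ∃ q ∈ w.toSet, r ∈ h.classOf q}, cen w⟩)
    refine Center.ext_nu (sub _ r hr) ht fun a ha => ?_
    rw [Center.nu_mul hp hq hr (hle ha), Center.nu_mul (sub z p hp) (sub w q hq) ht ha]

theorem maxQuotient_mono {g h : M.FusionSet} (hle : h ≤ g) : h.maxQuotient ≤ g.maxQuotient := by
  rintro a ⟨ha, ha'⟩
  refine ⟨hle ha, fun z _ p hp => ?_⟩
  exact ha' (Center.mk h p fun b hb => z.norm_nu hp (hle hb)) (Subgroup.mem_top _) p
    (Center.self_mem h p)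

theorem maxExtension_mono {g h : M.FusionSet} (hle : h ≤ g) :
    h.maxExtension ≤ g.maxExtension :=
  dual_anti (maxQuotient_mono (dual_anti hle))

/-- For `h ≤ g`, the subgroup `Z(g|h)` of the center of `g`: the central `g`-classes contained in
the dual of `h`. -/
def relCenter {g h : M.FusionSet} (hle : h ≤ g) : Subgroup g.Center where
  carrier := {z | z.toSet ⊆ h.dual}
  mul_mem' := by
    rintro z w hz hw r ⟨p, hp, q, hq, hr⟩
    exact h.dual.fusion_mem (hz hp) (hw hq) hr
  one_mem' := dual_anti hle
  inv_mem' := by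
    intro z hz q hq
    have h1 := hz (Center.mem_inv.mp hq)
    refine mem_dual.mpr fun a ha => ?_
    have h2 := mem_dual.mp h1 a ha
    rw [M.nu_conj] at h2
    simpa using congrArg star h2

end FusionSet

end RationalModel

/-! The proof is a duality between kernel, cokernel and relative centers under the normalized matrix
`nu`, where `nu p a` is `ρ_p(a)/d_a`. It is symmetric and bounded by 1 in modulus. The class of `p`
is central for `g` exactly when `nu p` has modulus 1 on `g`, and it is trivial exactly when `nu p`
equals 1 there. On central classes `nu` is multiplicative, so it restricts to bicharacters on pairs
of centers.

Comparing masses gives `dual_dual`. Hence the dual of `g/H` is the union of the classes in `H`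
(`dual_quotient`), and the maximal extension of `g` consists of all `p` with `|nu p| = 1` on the
dual of `g` (`mem_maxExtension`). If `h` is a central quotient of `g`, then `|nu| = 1` on `g ×
h.dual`.

The kernel of restriction consists of the central classes of `h.dual` contained in `g`. They pair
perfectly with the central `g`-classes filling `h.dual`, that is, with `Z(g|h)`. The center of
`g.dual` pairs with the relative center of the maximal extensions. That pairing is nondegenerate in
the second variable, and its left radical, the classes contained in `h.maxExtension`, is the image
of restriction. Since a finite abelian group is isomorphic, not canonically, to its character group,
the two pairings yield the outer maps. -/

/-- For a pairing of finite abelian groups which is nondegenerate in the second variable, the second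
group is a quotient of the first one by the radical of the pairing. -/
theorem CommGroup.exists_surjective_ker_eq_of_pairing {A B : Type*} [CommGroup A] [CommGroup B]
    [Finite A] [Finite B] (φ : A →* B →* ℂˣ) (hφ : ∀ b, (∀ a, φ a b = 1) → b = 1) :
    ∃ π : A →* B, Function.Surjective π ∧ π.ker = φ.ker := by
  obtain ⟨e⟩ := CommGroup.monoidHom_mulEquiv_of_hasEnoughRootsOfUnity B ℂ
  obtain ⟨e'⟩ := CommGroup.monoidHom_mulEquiv_of_hasEnoughRootsOfUnity φ.range ℂ
  have : Finite (B →* ℂˣ) := Finite.of_equiv _ e.symm.toEquiv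
  have : Finite (φ.range →* ℂˣ) := Finite.of_equiv _ e'.symm.toEquiv
  -- Nondegeneracy makes evaluation embed `B` into the characters of the range of `φ`. Since finite
  -- abelian groups have as many characters as elements, the range is at least as large as the full
  -- character group of `B`, so `φ` is onto.
  have hinj : Function.Injective
      (fun b => (MonoidHom.eval b).comp φ.range.subtype : B → φ.range →* ℂˣ) := by
    intro b c hbc
    rw [← mul_inv_eq_one]
    refine hφ _ fun a => ?_
    have h := DFunLike.congr_fun hbc ⟨φ a, a, rfl⟩
    rw [map_mul, map_inv, mul_inv_eq_one]
    exact h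
  have hcard : Nat.card (B →* ℂˣ) ≤ Nat.card φ.range := by
    rw [Nat.card_congr e.toEquiv, ← Nat.card_congr e'.toEquiv]
    exact Nat.card_le_card_of_injective _ hinj
  have htop : φ.range = ⊤ := Subgroup.eq_top_of_le_card _ hcard
  refine ⟨e.toMonoidHom.comp φ, e.surjective.comp (MonoidHom.range_eq_top.mp htop), ?_⟩
  ext a
  simp [MonoidHom.mem_ker]

namespace RationalModel

variable {P : Type*} [Fintype P] [DecidableEq P] {M : RationalModel P}

theorem nu_ne_zero_of_norm {p a : P} (h : ‖M.nu p a‖ = 1) : M.nu p a ≠ 0 :=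
  norm_ne_zero_iff.mp (by simp [h])

namespace FusionSet

/-! ### Masses and the double dual -/

theorem le_dual_dual (g : M.FusionSet) : g ≤ g.dual.dual := fun a ha =>
  mem_dual.mpr fun p hp => by rw [M.nu_symm]; exact mem_dual.mp hp a ha

/-- This is the case of the trivial class in `mass_mul`: since `ρ_0(a) = d_a`, the sum there is the
mass of `g`. -/
theorem mass_dual_mul_mass (g : M.FusionSet) :
    M.mass g.dual * M.mass g = (M.s M.vac ^ 2)⁻¹ := by
  rw [← g.mass_mul M.vac]
  congr 1
  refine Finset.sum_congr rfl fun a _ => ?_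
  congr 1
  ext a
  rw [M.rho_eq_nu, M.nu_vac, one_mul, norm_div, Complex.norm_real, Complex.norm_real,
    Real.norm_of_nonneg (M.s_pos a).le, Real.norm_of_nonneg (M.s_pos M.vac).le]
  rfl

/-- The product formula for `g` and for its dual forces `g` and the double dual to have equal mass.
One contains the other and every primary has positive mass, so nothing can be missing. -/
theorem dual_dual (g : M.FusionSet) : g.dual.dual = g := by
  have h1 := g.mass_dual_mul_mass
  have h2 := g.dual.mass_dual_mul_mass
  have hne : M.mass g.dual ≠ 0 := fun h => by
    rw [h, zero_mul] at h1
    exact (inv_pos.mpr (pow_pos (M.s_pos M.vac) 2)).ne h1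
  have hm : M.mass g = M.mass g.dual.dual :=
    mul_left_cancel₀ hne (h1.trans (h2.symm.trans (mul_comm _ _)))
  have hpos : ∀ a, 0 < M.qdim a ^ 2 := fun a =>
    pow_pos (div_pos (M.s_pos a) (M.s_pos M.vac)) 2
  have hle : ∀ a ∈ Finset.univ, (g : Set P).indicator (fun p => M.qdim p ^ 2) a
      ≤ (g.dual.dual : Set P).indicator (fun p => M.qdim p ^ 2) a := fun a _ =>
    Set.indicator_le_indicator_of_subset g.le_dual_dual (fun a => (hpos a).le) a
  have heq := (Finset.sum_eq_sum_iff_of_le hle).mp hm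
  refine le_antisymm (fun a ha => ?_) g.le_dual_dual
  have h3 := heq a (Finset.mem_univ a)
  rw [Set.indicator_of_mem (s := (g.dual.dual : Set P)) ha] at h3
  by_contra hn
  rw [Set.indicator_of_notMem (s := (g : Set P)) hn] at h3
  exact (hpos a).ne h3

/-! ### Supports, central quotients and maximal extensions -/

instance (g : M.FusionSet) : Finite g.Center := by unfold Center; infer_instance

theorem Center.eq_one_iff {g : M.FusionSet} {z : g.Center} {p : P} (hp : p ∈ z.toSet) :
    z = 1 ↔ ∀ a ∈ g, M.nu p a = 1 := by
  constructor
  · rintro rfl a ha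
    exact nu_one hp ha
  · intro h
    exact ext_nu hp (self_mem g M.vac) fun a ha => by rw [h a ha, M.nu_vac]

/-- The union of the classes belonging to a subgroup of the center. -/
def support {g : M.FusionSet} (H : Subgroup g.Center) : M.FusionSet where
  carrier := {p | ∃ z ∈ H, p ∈ z.toSet}
  vac_mem := ⟨1, H.one_mem, Center.self_mem g M.vac⟩
  fusion_mem := by
    rintro p q r ⟨z, hz, hp⟩ ⟨w, hw, hq⟩ hr
    exact ⟨z * w, H.mul_mem hz hw, p, hp, q, hq, hr⟩

theorem dual_le_support {g : M.FusionSet} (H : Subgroup g.Center) : g.dual ≤ support H :=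
  fun _ hp => ⟨1, H.one_mem, hp⟩

theorem quotient_eq_dual_support {g : M.FusionSet} (H : Subgroup g.Center) :
    g.quotient H = (support H).dual := by
  refine le_antisymm ?_ fun a ha => ⟨?_, fun z hz p hp => ?_⟩
  · rintro a ⟨-, ha⟩
    refine mem_dual.mpr ?_
    rintro p ⟨z, hz, hp⟩
    rw [M.nu_symm, ← M.rho_vac_eq_iff]
    exact ha z hz p hp
  -- Membership in `g` is automatic: the support contains the dual of `g`, so its dual lies in the
  -- double dual.
  · rw [← g.dual_dual]
    exact dual_anti (dual_le_support H) ha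
  · rw [M.rho_vac_eq_iff, M.nu_symm]
    exact mem_dual.mp ha p ⟨z, hz, hp⟩

theorem dual_quotient {g : M.FusionSet} (H : Subgroup g.Center) :
    (g.quotient H).dual = support H := by
  rw [quotient_eq_dual_support, dual_dual]

/-- By `dual_quotient`, the maximal extension is the union of all central classes of `g.dual`, and
centrality is the condition of modulus 1. -/
theorem mem_maxExtension {g : M.FusionSet} {p : P} :
    p ∈ g.maxExtension ↔ ∀ a ∈ g.dual, ‖M.nu p a‖ = 1 := by
  rw [maxExtension, maxQuotient, dual_quotient]
  constructor
  · rintro ⟨z, -, hp⟩ a ha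
    exact z.norm_nu hp ha
  · exact fun hp => ⟨Center.mk _ p hp, Subgroup.mem_top _, Center.self_mem _ p⟩

/-- The dual of `g/H` is filled by the classes in `H`, which are central for `g`. Beyond the
inclusion `h ≤ g`, the exact sequence needs only this consequence of the hypothesis. -/
theorem IsCentralQuotient.norm_nu {g h : M.FusionSet} (hq : h.IsCentralQuotient g) {p a : P}
    (hp : p ∈ g) (ha : a ∈ h.dual) : ‖M.nu p a‖ = 1 := by
  obtain ⟨H, rfl⟩ := hq
  rw [dual_quotient] at ha
  obtain ⟨z, -, hz⟩ := ha
  rw [M.nu_symm]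
  exact z.norm_nu hz hp

theorem IsCentralQuotient.le_maxExtension {g h : M.FusionSet} (hq : h.IsCentralQuotient g) :
    g ≤ h.maxExtension :=
  fun _ hp => mem_maxExtension.mpr fun _ ha => hq.norm_nu hp ha

theorem mem_res {g h : M.FusionSet} (hle : h ≤ g) {z : g.Center} {p : P} (hp : p ∈ z.toSet) :
    p ∈ (res hle z).toSet :=
  ⟨p, hp, Center.self_mem h p⟩

/-! ### Pairings of centers -/

/-- The pairing, induced by the matrix `S`, of subgroups of the centers of `x` and `y`. -/
theorem exists_pairing {x y : M.FusionSet} (A : Subgroup x.Center) (B : Subgroup y.Center)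
    (hA : ∀ z ∈ A, z.toSet ⊆ y) (hB : ∀ w ∈ B, w.toSet ⊆ x) :
    ∃ φ : A →* B →* ℂˣ, ∀ (z : A) (w : B), ∀ p ∈ z.1.toSet, ∀ q ∈ w.1.toSet,
      (φ z w : ℂ) = M.nu p q := by
  choose f hf using fun z : A => z.1.nonempty
  choose k hk using fun w : B => w.1.nonempty
  -- Independence of representatives: the first can vary because the second lies in `x`, and then
  -- the second can vary because the first lies in `y`.
  have hnu : ∀ (z : A) (w : B), ∀ p ∈ z.1.toSet, ∀ q ∈ w.1.toSet,
      M.nu (f z) (k w) = M.nu p q := fun z w p hp q hq => by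
    rw [z.1.nu_eq (hf z) hp (hB _ w.2 (hk w)), M.nu_symm, M.nu_symm p,
      w.1.nu_eq (hk w) hq (hA _ z.2 hp)]
  have hne : ∀ z w, M.nu (f z) (k w) ≠ 0 := fun z w =>
    nu_ne_zero_of_norm (z.1.norm_nu (hf z) (hB _ w.2 (hk w)))
  let F : A → B → ℂˣ := fun z w => Units.mk0 _ (hne z w)
  have hFr : ∀ z w w', F z (w * w') = F z w * F z w' := fun z w w' => Units.ext <| by
    simp only [F, Units.val_mk0, Units.val_mul]
    rw [M.nu_symm, M.nu_symm _ (k w), M.nu_symm _ (k w')]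
    exact Center.nu_mul (hk w) (hk w') (hk (w * w')) (hA _ z.2 (hf z))
  have hFl : ∀ z z' w, F (z * z') w = F z w * F z' w := fun z z' w => Units.ext <| by
    simp only [F, Units.val_mk0, Units.val_mul]
    exact Center.nu_mul (hf z) (hf z') (hf (z * z')) (hB _ w.2 (hk w))
  exact ⟨MonoidHom.mk' (fun z => MonoidHom.mk' (F z) (hFr z)) fun z z' =>
    MonoidHom.ext (hFl z z'), hnu⟩

/-- Since the classes in `A` cover `y`, a class in `B` that pairs trivially with all of `A` has `nu
= 1` on `y` and is trivial. The pairing is thus nondegenerate in `B`, and the kernel of `π` is its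
left radical. -/
theorem exists_surjective_of_pairing {x y : M.FusionSet} (A : Subgroup x.Center)
    (B : Subgroup y.Center) (hA : ∀ z ∈ A, z.toSet ⊆ y) (hB : ∀ w ∈ B, w.toSet ⊆ x)
    (hy : ∀ p ∈ y, ∃ z ∈ A, p ∈ z.toSet) :
    ∃ π : A →* B, Function.Surjective π ∧ ∀ (z : A), ∀ p ∈ z.1.toSet,
      (z ∈ π.ker ↔ ∀ q ∈ support B, M.nu p q = 1) := by
  obtain ⟨φ, hφ⟩ := exists_pairing A B hA hB
  obtain ⟨π, hπ, hker⟩ := CommGroup.exists_surjective_ker_eq_of_pairing φ fun w hw => by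
    obtain ⟨q, hq⟩ := w.1.nonempty
    refine Subtype.ext ((Center.eq_one_iff hq).mpr fun p hp => ?_)
    obtain ⟨z, hz, hpz⟩ := hy p hp
    rw [M.nu_symm, ← hφ ⟨z, hz⟩ w p hpz q hq, hw, Units.val_one]
  refine ⟨π, hπ, fun z p hp => ?_⟩
  rw [hker, MonoidHom.mem_ker]
  constructor
  · rintro hz q ⟨w, hw, hq⟩
    rw [← hφ z ⟨w, hw⟩ p hp q hq, hz, MonoidHom.one_apply, Units.val_one]
  · intro h
    ext w
    obtain ⟨q, hq⟩ := w.1.nonempty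
    rw [hφ z w p hp q hq, h q ⟨w.1, w.2, hq⟩, MonoidHom.one_apply, Units.val_one]

/-- Under `hn` each primary of `h.dual` has a central `g`-class, and this class stays inside
`h.dual` because `h ≤ g`. -/
theorem support_relCenter {g h : M.FusionSet} (hle : h ≤ g)
    (hn : ∀ p ∈ g, ∀ q ∈ h.dual, ‖M.nu p q‖ = 1) : support (relCenter hle) = h.dual := by
  refine le_antisymm ?_ fun q hq => ?_
  · rintro q ⟨w, hw, hq⟩
    exact hw hq
  · refine ⟨Center.mk g q fun a ha => by rw [M.nu_symm]; exact hn a ha q hq, fun r hr => ?_,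
      Center.self_mem g q⟩
    refine mem_dual.mpr fun a ha => ?_
    rw [mem_classOf.mp hr a (hle ha)]
    exact mem_dual.mp hq a ha

/-! ### Kernel and cokernel of restriction -/

theorem mem_ker_res {g h : M.FusionSet} (hle : h ≤ g) {z : g.Center} {p : P} (hp : p ∈ z.toSet) :
    z ∈ (res hle).ker ↔ p ∈ h.dual := by
  rw [MonoidHom.mem_ker, Center.eq_one_iff (mem_res hle hp), mem_dual]

/-- The relative center is isomorphic to the kernel of the restriction homomorphism. -/
theorem nonempty_relCenter_mulEquiv_ker {g h : M.FusionSet} (hq : h.IsCentralQuotient g) :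
    Nonempty (relCenter hq.le ≃* (res (dual_anti hq.le)).ker) := by
  have hg : ∀ {z : h.dual.Center} {p : P}, p ∈ z.toSet →
      (z ∈ (res (dual_anti hq.le)).ker ↔ p ∈ g) := fun hp => by
    rw [mem_ker_res _ hp, dual_dual]
  obtain ⟨π, hπ, hker⟩ := exists_surjective_of_pairing (res (dual_anti hq.le)).ker
    (relCenter hq.le) (fun z hz p hp => (hg hp).mp hz) (fun w hw => hw) fun p hp =>
      ⟨Center.mk h.dual p fun a ha => hq.norm_nu hp ha, (hg (Center.self_mem _ p)).mpr hp,
        Center.self_mem _ p⟩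
  -- As `Z(g|h)` fills `h.dual`, an element of the left radical has `nu = 1` on all of `h.dual` and
  -- so is trivial: the pairing is perfect.
  rw [support_relCenter _ fun p hp q hq' => hq.norm_nu hp hq'] at hker
  refine ⟨(MulEquiv.ofBijective π ⟨(injective_iff_map_eq_one π).mpr fun z hz => ?_, hπ⟩).symm⟩
  obtain ⟨p, hp⟩ := z.1.nonempty
  exact Subtype.ext ((Center.eq_one_iff hp).mpr ((hker z p hp).mp hz))

/-- The cokernel of the restriction homomorphism is isomorphic to the relative center of the maximal
central extensions. -/
theorem exists_surjective_ker_eq_range_res {g h : M.FusionSet} (hq : h.IsCentralQuotient g) :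
    ∃ π : g.dual.Center →* relCenter (maxExtension_mono hq.le),
      (res (dual_anti hq.le)).range = π.ker ∧ Function.Surjective π := by
  -- This inclusion places the classes of the relative center inside `g.dual`, as the pairing with
  -- the center of `g.dual` requires.
  have hdual : h.maxExtension.dual ≤ g.dual := dual_anti hq.le_maxExtension
  have hmem : ∀ (z : g.dual.Center) (p : P), p ∈ z.toSet → p ∈ g.maxExtension := fun z p hp =>
    mem_maxExtension.mpr fun a ha => z.norm_nu hp ha
  obtain ⟨π, hπ, hker⟩ := exists_surjective_of_pairing (⊤ : Subgroup g.dual.Center)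
    (relCenter (maxExtension_mono hq.le)) (fun z _ p hp => hmem z p hp)
    (fun w hw => hw.trans hdual) fun p hp =>
      ⟨Center.mk g.dual p (mem_maxExtension.mp hp), Subgroup.mem_top _, Center.self_mem _ p⟩
  rw [support_relCenter _ fun p hp q hq' => mem_maxExtension.mp hp q (hdual hq')] at hker
  have hsurj : Function.Surjective (π.comp Subgroup.topEquiv.symm.toMonoidHom) := by
    rw [MonoidHom.coe_comp]
    exact hπ.comp (MulEquiv.surjective _)
  refine ⟨π.comp Subgroup.topEquiv.symm.toMonoidHom, ?_, hsurj⟩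
  ext z
  obtain ⟨p, hp⟩ := z.nonempty
  -- The relative center fills `h.maxExtension.dual`, so the radical is cut out by its dual, which
  -- is `h.maxExtension` again.
  have hz : z ∈ (π.comp Subgroup.topEquiv.symm.toMonoidHom).ker ↔
      p ∈ h.maxExtension.dual.dual := by
    rw [mem_dual, ← hker ⟨z, Subgroup.mem_top z⟩ p hp]
    rfl
  rw [hz, dual_dual]
  constructor
  · rintro ⟨w, rfl⟩
    obtain ⟨r, hr⟩ := w.nonempty
    have hr' : r ∈ h.maxExtension := mem_maxExtension.mpr fun a ha => w.norm_nu hr ha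
    -- The representative `p` of the restricted class need not lie in `w`, but `nu p` and `nu r`
    -- agree on `g.dual`, hence on `h.maxExtension.dual`; that decides membership in the double
    -- dual.
    rw [← h.maxExtension.dual_dual] at hr' ⊢
    refine mem_dual.mpr fun a ha => ?_
    rw [Center.nu_eq _ hp (mem_res _ hr) (hdual ha)]
    exact mem_dual.mp hr' a ha
  · intro hp'
    -- Membership in `h.maxExtension` says that the `h.dual`-class of `p` is central; it is the
    -- required preimage.
    refine ⟨Center.mk h.dual p (mem_maxExtension.mp hp'), ?_⟩
    exact Center.ext_nu (mem_res _ (Center.self_mem _ p)) hp fun _ _ => rfl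

end FusionSet

end RationalModel

theorem mainTheorem9 {P : Type*} [Fintype P] [DecidableEq P] (M : RationalModel P)
    (g h : M.FusionSet) (hq : h.IsCentralQuotient g) :
    ∃ (ι : RationalModel.FusionSet.relCenter hq.le →* h.dual.Center)
      (π : g.dual.Center →*
        RationalModel.FusionSet.relCenter (RationalModel.FusionSet.maxExtension_mono hq.le)),
      Function.Injective ι ∧
      ι.range = (RationalModel.FusionSet.res (RationalModel.FusionSet.dual_anti hq.le)).ker ∧
      (RationalModel.FusionSet.res (RationalModel.FusionSet.dual_anti hq.le)).range = π.ker ∧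
      Function.Surjective π := by
  obtain ⟨e⟩ := RationalModel.FusionSet.nonempty_relCenter_mulEquiv_ker hq
  obtain ⟨π, hrange, hπ⟩ := RationalModel.FusionSet.exists_surjective_ker_eq_range_res hq
  refine ⟨(Subgroup.subtype _).comp e.toMonoidHom, π,
    Subtype.val_injective.comp e.injective, ?_, hrange, hπ⟩
  rw [MonoidHom.range_comp, MonoidHom.range_eq_top.mpr e.surjective, ← MonoidHom.range_eq_map,
    Subgroup.range_subtype]
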